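/- All graphs are finite, undirected and have no parallel edges and, unless stated otherwise, no loops. A graph is nontrivial if it has at least two vertices, and $R$-thin if distinct vertices have distinct neighbourhoods. $\Gamma\times\Sigma$ is the direct product: $(u,i)$ and $(v,j)$ are adjacent iff $u,v$ are adjacent in $\Gamma$ and $i,j$ are adjacent in $\Sigma$. The pair $(\Gamma,\Sigma)$ is stable if $\mathrm{Aut}(\Gamma\times\Sigma)\cong\mathrm{Aut}(\Gamma)\times\mathrm{Aut}(\Sigma)$ as groups, and unstable otherwise. $\Gamma$ and $\Sigma$ are coprime if there is no nontrivial graph $\Delta$ with $\Gamma\cong\Gamma'\times\Delta$ and $\Sigma\cong\Sigma'\times\Delta$ for some graphs $\Gamma',\Sigma'$. An unstable pair $(\Gamma,\Sigma)$ is nontrivially unstable if $\Gamma$ and $\Sigma$ are $R$-thin, connected and coprime and at least one of them is non-bipartite. A $\Sigma$-automorphism of $\Gamma$ is a family $(\alpha_i)_{i\in V(\Sigma)}$ of permutations of $V(\Gamma)$ such that, for all $u,v\in V(\Gamma)$ and all $i,j$ adjacent in $\Sigma$, $\{u,v\}\in E(\Gamma)$ iff $\{u^{\alpha_i},v^{\alpha_j}\}\in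 E(\Gamma)$; it is nondiagonal if $\alpha_i\ne\alpha_j$ for some $i,j$. $\Gamma^*$ is the graph on $V(\Gamma)$ in which distinct $u,v$ are adjacent iff $\deg_\Gamma(u)=\deg_\Gamma(v)=2|N_\Gamma(u)\cap N_\Gamma(v)|$. For $u\in V(\Gamma)$ let $L(u)=\{0\}$ if $u$ has degree $0$ in $\Gamma^*$, $L(u)=\{0,1\}$ if $u$ has degree $1$ in $\Gamma^*$, and otherwise let $L(u)$ be the set of lengths of the cycles of $\Gamma^*$ containing $u$. An integer $n\ge 3$ is compatible with $\Gamma$ if $n$ is odd and $n\notin L(u)$ for some $u\in V(\Gamma)$, or $n$ is even and $n/2\notin L(u)$ for some $u\in V(\Gamma)$. **Theorem.** Let $\Gamma$ be a nontrivial $R$-thin connected graph and $n\ge3$ an integer with $n\neq4$, and suppose that at least one of $\Gamma$ and the cycle $C_n$ is non-bipartite. (a) If $n$ is compatible with $\Gamma$, then $(\Gamma,C_n)$ is nontrivially unstable if and only if at least one $C_n$-automorphism of $\Gamma$ is nondiagonal. (b) If $n\ge5$ is odd and, for every $\{u,v\}\in E(\Gamma^*)$, $N_\Gamma(u)\cap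 N_\Gamma(v)$ is not an independent set of $\Gamma$, then $(\Gamma,C_n)$ is nontrivially unstable if and only if at least one $C_n$-automorphism of $\Gamma$ is nondiagonal. Both equivalences hold under either convention for coprimality: with loops forbidden or with loops allowed in the graphs $\Delta,\Gamma',\Sigma'$. -/

import Mathlib

namespace GraphPair

/-- The direct (categorical) product of two graphs. -/
def directProd {V W : Type*} (G : SimpleGraph V) (H : SimpleGraph W) : SimpleGraph (V × W) where
  Adj x y := G.Adj x.1 y.1 ∧ H.Adj x.2 y.2
  symm := ⟨fun _ _ h => ⟨h.1.symm, h.2.symm⟩⟩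
  loopless := ⟨fun _ h => G.loopless.irrefl _ h.1⟩

/-- Distinct vertices have distinct neighbourhoods. -/
def RThin {V : Type*} (G : SimpleGraph V) : Prop :=
  ∀ u v : V, G.neighborSet u = G.neighborSet v → u = v

/-- `Aut(G) × Aut(H)` and `Aut(G × H)` are isomorphic as groups. -/
def Stable {V W : Type*} (G : SimpleGraph V) (H : SimpleGraph W) : Prop :=
  Nonempty (((G ≃g G) × (H ≃g H)) ≃* (directProd G H ≃g directProd G H))

/-- No graph with at least two vertices is a common direct factor of `G` and `H`;
all factors are simple graphs. -/
def Coprime {V W : Type*} (G : SimpleGraph V) (H : SimpleGraph W) : Prop :=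
  ¬ ∃ (A B D : Type) (G' : SimpleGraph A) (H' : SimpleGraph B) (K : SimpleGraph D),
    Finite A ∧ Finite B ∧ Finite D ∧ Nontrivial D ∧
    Nonempty (G ≃g directProd G' K) ∧ Nonempty (H ≃g directProd H' K)

/-- Undirected graphs without parallel edges in which loops are allowed. -/
structure LoopGraph (V : Type*) where
  Adj : V → V → Prop
  symm : ∀ x y, Adj x y → Adj y x

/-- The direct product of two graphs that may have loops. -/
def LoopGraph.directProd {V W : Type*} (G : LoopGraph V) (H : LoopGraph W) :
    LoopGraph (V × W) where
  Adj x y := G.Adj x.1 y.1 ∧ H.Adj x.2 y.2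
  symm _ _ h := ⟨G.symm _ _ h.1, H.symm _ _ h.2⟩

/-- Coprimality with respect to the direct product in the class of graphs with loops allowed,
where the one-vertex graph with a loop is the unit of the product. -/
def LoopCoprime {V W : Type*} (G : SimpleGraph V) (H : SimpleGraph W) : Prop :=
  ¬ ∃ (A B D : Type) (G' : LoopGraph A) (H' : LoopGraph B) (K : LoopGraph D),
    Finite A ∧ Finite B ∧ Finite D ∧ Nontrivial D ∧
    Nonempty (G.Adj ≃r (G'.directProd K).Adj) ∧ Nonempty (H.Adj ≃r (H'.directProd K).Adj)

/-- The pair is unstable, and both graphs are `R`-thin, connected and coprime,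
at least one of them being non-bipartite. -/
def NontriviallyUnstable {V W : Type*} (G : SimpleGraph V) (H : SimpleGraph W) : Prop :=
  ¬ Stable G H ∧ RThin G ∧ RThin H ∧ G.Connected ∧ H.Connected ∧ Coprime G H ∧
    (¬ G.IsBipartite ∨ ¬ H.IsBipartite)

/-- The same notion, with coprimality taken in the class of graphs with loops allowed. -/
def LoopNontriviallyUnstable {V W : Type*} (G : SimpleGraph V) (H : SimpleGraph W) : Prop :=
  ¬ Stable G H ∧ RThin G ∧ RThin H ∧ G.Connected ∧ H.Connected ∧ LoopCoprime G H ∧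
    (¬ G.IsBipartite ∨ ¬ H.IsBipartite)

/-- `α` is an `H`-automorphism of `G`: a tuple of permutations of the vertices of `G`,
indexed by the vertices of `H`. -/
def IsTupleAut {V W : Type*} (G : SimpleGraph V) (H : SimpleGraph W)
    (α : W → Equiv.Perm V) : Prop :=
  ∀ u v : V, ∀ i j : W, H.Adj i j → (G.Adj u v ↔ G.Adj (α i u) (α j v))

/-- The tuple is not constant. -/
def Nondiagonal {V W : Type*} (α : W → Equiv.Perm V) : Prop :=
  ∃ i j : W, α i ≠ α j

/-- The auxiliary graph `Γ*`: distinct `u`, `v` are adjacent iff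
`deg u = deg v = 2 |N(u) ∩ N(v)|`. -/
def star {V : Type*} (G : SimpleGraph V) : SimpleGraph V where
  Adj u v := u ≠ v ∧ (G.neighborSet u).ncard = (G.neighborSet v).ncard ∧
    (G.neighborSet v).ncard = 2 * (G.neighborSet u ∩ G.neighborSet v).ncard
  symm := ⟨fun u v h => ⟨h.1.symm, h.2.1.symm, by
    rw [Set.inter_comm, h.2.1]; exact h.2.2⟩⟩
  loopless := ⟨fun _ h => h.1 rfl⟩

/-- The set `L(u)`: `{0}` or `{0, 1}` if `u` has degree `0` or `1` in `Γ*`, and otherwise the set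
of lengths of the cycles of `Γ*` through `u`. -/
def cycleLengths {V : Type*} (G : SimpleGraph V) (u : V) : Set ℕ :=
  {l | (((star G).neighborSet u).ncard = 0 ∧ l = 0) ∨
    (((star G).neighborSet u).ncard = 1 ∧ (l = 0 ∨ l = 1)) ∨
    (2 ≤ ((star G).neighborSet u).ncard ∧ ∃ p : (star G).Walk u u, p.IsCycle ∧ p.length = l)}

/-- The integer `n` (meant to be at least `3`) is compatible with `G`. -/
def Compatible {V : Type*} (n : ℕ) (G : SimpleGraph V) : Prop :=
  (Odd n ∧ ∃ u : V, n ∉ cycleLengths G u) ∨ (Even n ∧ ∃ u : V, n / 2 ∉ cycleLengths G u)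

end GraphPair

/-!
Index the cycle by the residues modulo `n`; call `{u} × ℤ/n` the fibre over `u`, and `V × {i}` a
layer. Since `n ≠ 4`, the residues `i` and `i + 2` have exactly one common neighbour, so in `Γ × Cₙ`
the vertices `(u, i)` and `(u, i + 2)` have equal degrees, twice the number of their common
neighbours. Counting shows that the only pairs with this property are the vertical ones, edges of
`Γ*` inside a layer, and the horizontal ones, `(p, j)` and `(p, j ± 2)` (`image_step`). Hence an
automorphism `φ` maps the sequence `(u, i)`, `(u, i + 2)`, `(u, i + 4)`, … to a sequence with
vertical and horizontal steps. The types of steps never change along the sequence: a horizontal and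
a vertical step in succession would join three vertices with a common neighbour, but `i`, `i + 2`,
`i + 4` have none (`image_step_vertical`, `image_step_horizontal`).

If one such sequence is horizontal, `φ` acts on its second coordinate as a rotation or a reflection
of the cycle, and this spreads along the edges of `Γ × Cₙ`, which is connected because one of the
factors is non-bipartite (`affine_everywhere`). Then `φ` amounts to a `Cₙ`-automorphism of `Γ` and a
symmetry of the cycle, and it is a product of automorphisms of the factors when that tuple is
diagonal (`mem_range_of_affine`). If all sequences are vertical, they trace out cycles of `Γ*` of
length `n` or `n / 2` through every vertex, against compatibility (`mem_range_of_compatible`).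
Under the hypothesis of the second equivalence they instead pull back an edge between common
neighbours to an edge inside a layer (`mem_range_of_not_isIndepSet`). So if all
`Cₙ`-automorphisms are diagonal, then the pair is stable; conversely a nondiagonal one is an
automorphism of `Γ × Cₙ` outside the image of `Aut(Γ) × Aut(Cₙ)`, and the groups are finite
(`stable_iff_surjective`).

Coprimality follows from the hypotheses. A nontrivial factor `K` of `Cₙ` is either `K₂`, which as a
common factor would make both graphs bipartite, or 2-regular; in the latter case the steps of length
two in `K` produce in `Γ*` the cycles, and the edges with independent sets of common neighbours,
that the hypotheses exclude (`of_not_loopCoprime`).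
-/

namespace GraphPair

/-! ### Cycles indexed by residues -/

/-- `C` is the cycle of length `n` on the residues modulo `n`, where `n ≥ 3` and `n ≠ 4`. -/
structure IsResidueCycle {n : ℕ} (C : SimpleGraph (ZMod n)) : Prop where
  three_le : 3 ≤ n
  ne_four : n ≠ 4
  adj_iff : ∀ i j, C.Adj i j ↔ j = i + 1 ∨ j = i - 1

namespace IsResidueCycle

variable {n : ℕ} {C : SimpleGraph (ZMod n)}

lemma two_ne_zero (hC : IsResidueCycle C) : (2 : ZMod n) ≠ 0 := by
  intro h
  have h' : ((2 : ℕ) : ZMod n) = 0 := by exact_mod_cast h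
  have := Nat.le_of_dvd (by norm_num) ((ZMod.natCast_eq_zero_iff 2 n).1 h')
  have := hC.three_le
  omega

lemma four_ne_zero (hC : IsResidueCycle C) : (4 : ZMod n) ≠ 0 := by
  intro h
  have h' : ((4 : ℕ) : ZMod n) = 0 := by exact_mod_cast h
  have hd := (ZMod.natCast_eq_zero_iff 4 n).1 h'
  have := Nat.le_of_dvd (by norm_num) hd
  have h3 := hC.three_le
  have h4 := hC.ne_four
  have : n = 3 := by omega
  subst this
  omega

/-- Both `2` and `4` are nonzero, in a form that `grind` can use: its ring solver discards
equations between numerals. -/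
lemma exists_one (hC : IsResidueCycle C) : ∃ t : ZMod n, t = 1 ∧ 2 * t ≠ 0 ∧ 4 * t ≠ 0 :=
  ⟨1, rfl, by simpa using hC.two_ne_zero, by simpa using hC.four_ne_zero⟩

lemma finite (hC : IsResidueCycle C) : Finite (ZMod n) := by
  have : NeZero n := ⟨by have := hC.three_le; omega⟩
  infer_instance

lemma exists_natCast (hC : IsResidueCycle C) (x : ZMod n) : ∃ k : ℕ, (k : ZMod n) = x := by
  have : NeZero n := ⟨by have := hC.three_le; omega⟩
  exact ZMod.natCast_zmod_surjective x

lemma ncard_neighborSet (hC : IsResidueCycle C) (i : ZMod n) : (C.neighborSet i).ncard = 2 := by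
  have h : C.neighborSet i = {i + 1, i - 1} := by
    ext j; simp [hC.adj_iff]
  obtain ⟨t, ht, h2, h4⟩ := hC.exists_one
  rw [h, Set.ncard_pair]
  grind

lemma inter_neighborSet (hC : IsResidueCycle C) (i : ZMod n) :
    C.neighborSet i ∩ C.neighborSet (i + 2) = {i + 1} := by
  obtain ⟨t, ht, h2, h4⟩ := hC.exists_one
  ext j
  simp only [Set.mem_inter_iff, SimpleGraph.mem_neighborSet, hC.adj_iff, Set.mem_singleton_iff]
  grind

lemma inter_neighborSet_eq_empty (hC : IsResidueCycle C) {i j : ZMod n} (h0 : j ≠ i)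
    (h1 : j ≠ i + 2) (h2 : j ≠ i - 2) : C.neighborSet i ∩ C.neighborSet j = ∅ := by
  ext k
  simp only [Set.mem_inter_iff, SimpleGraph.mem_neighborSet, hC.adj_iff, Set.mem_empty_iff_false]
  grind

lemma rThin (hC : IsResidueCycle C) : RThin C := by
  intro i j h
  obtain ⟨t, ht, h2, h4⟩ := hC.exists_one
  have ha : i + 1 ∈ C.neighborSet j := h ▸ (hC.adj_iff i _).2 (Or.inl rfl)
  have hb : i - 1 ∈ C.neighborSet j := h ▸ (hC.adj_iff i _).2 (Or.inr rfl)
  simp only [SimpleGraph.mem_neighborSet, hC.adj_iff] at ha hb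
  grind

lemma not_common_neighbor (hC : IsResidueCycle C) {i k : ZMod n} (ha : C.Adj i k)
    (hb : C.Adj (i + 2) k) (hc : C.Adj (i + 4) k) : False := by
  obtain ⟨t, ht, h2, h4⟩ := hC.exists_one
  simp only [hC.adj_iff] at ha hb hc
  grind

end IsResidueCycle

/-- The order of `2` in the integers modulo `n`: the length of a cycle of steps of length `2`. -/
def halfLength (n : ℕ) : ℕ := if Odd n then n else n / 2

lemma compatible_iff {V : Type*} {n : ℕ} {G : SimpleGraph V} :
    Compatible n G ↔ ∃ u, halfLength n ∉ cycleLengths G u := by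
  unfold Compatible halfLength
  split_ifs with h
  · simp [h, Nat.not_even_iff_odd.2 h]
  · simp [h, Nat.not_odd_iff_even.1 h]

lemma two_mul_natCast_eq_iff {n : ℕ} (k l : ℕ) :
    (2 * k : ZMod n) = 2 * l ↔ k ≡ l [MOD halfLength n] := by
  have h : (2 * k : ZMod n) = 2 * l ↔ 2 * k ≡ 2 * l [MOD n] := by
    rw [← ZMod.natCast_eq_natCast_iff]; push_cast; rfl
  rw [h]
  unfold halfLength
  split_ifs with ho
  · constructor
    · intro h
      exact Nat.ModEq.cancel_left_of_coprime (by simpa using ho) h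
    · exact fun h => h.mul_left 2
  · obtain ⟨m, rfl⟩ := Nat.not_odd_iff_even.1 ho
    rw [← two_mul, Nat.mul_div_cancel_left _ two_pos]
    exact ⟨fun h => Nat.ModEq.mul_left_cancel' two_ne_zero h, fun h => h.mul_left' 2⟩

/-- If `n` is odd, every residue is a multiple of `2`. -/
lemma exists_two_mul_eq {n : ℕ} (hn : Odd n) (x : ZMod n) : ∃ y, x = 2 * y := by
  obtain ⟨m, rfl⟩ := hn
  refine ⟨(m + 1) * x, ?_⟩
  have : ((2 * m + 1 : ℕ) : ZMod (2 * m + 1)) = 0 := ZMod.natCast_self _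
  push_cast at this
  linear_combination -x * this

/-- A closed sequence of vertices of `Γ*` that repeats exactly with period `m ≥ 3` is a cycle. -/
lemma mem_cycleLengths {V : Type*} [Finite V] {G : SimpleGraph V} {m : ℕ} (hm : 3 ≤ m)
    (w : ℕ → V) (hadj : ∀ k, (star G).Adj (w k) (w (k + 1)))
    (hw : ∀ k l, w k = w l ↔ k ≡ l [MOD m]) : m ∈ cycleLengths G (w 0) := by
  obtain ⟨n, rfl⟩ : ∃ n, m = n + 3 := ⟨m - 3, by omega⟩
  have step : ∀ a b : Fin (n + 3), a - b = 1 → (star G).Adj (w b) (w a) := by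
    intro a b h
    have : w a = w (b + 1) := by
      rw [hw, sub_eq_iff_eq_add'.1 h, Nat.ModEq, Fin.val_add]
      simp
    rw [this]
    exact hadj _
  let f : SimpleGraph.cycleGraph (n + 3) →g star G :=
    ⟨fun i => w i, fun {a b} h => by
      rcases SimpleGraph.cycleGraph_adj.1 h with h | h
      · exact (step _ _ h).symm
      · exact step _ _ h⟩
  have hf : Function.Injective f := by
    intro a b h
    have := (hw _ _).1 h
    rw [Nat.ModEq, Nat.mod_eq_of_lt a.2, Nat.mod_eq_of_lt b.2] at this
    exact Fin.ext this
  refine Or.inr (Or.inr ⟨?_, ?_⟩)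
  · have h1 : w 1 ≠ w (n + 2) := by
      rw [Ne, hw, Nat.ModEq, Nat.mod_eq_of_lt (by omega), Nat.mod_eq_of_lt (by omega)]
      omega
    rw [← Set.ncard_pair h1]
    refine Set.ncard_le_ncard ?_ (Set.toFinite _)
    rintro x (rfl | rfl)
    · exact hadj 0
    · have := (hadj (n + 2)).symm
      rwa [(hw (n + 2 + 1) 0).2 (by simp [Nat.ModEq])] at this
  · exact ⟨(SimpleGraph.cycleGraph.cycle n).map f,
      (SimpleGraph.Walk.isCycle_map_iff_of_injective hf).2 SimpleGraph.cycleGraph.isCycle_cycle,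
      (SimpleGraph.Walk.length_map _ _).trans SimpleGraph.cycleGraph.length_cycle⟩

/-! ### Automorphisms of a direct product and stability -/

section Product

variable {V W : Type*} {G : SimpleGraph V} {H : SimpleGraph W}

lemma neighborSet_directProd (x : V × W) :
    (directProd G H).neighborSet x = G.neighborSet x.1 ×ˢ H.neighborSet x.2 := rfl

lemma inter_neighborSet_directProd (x y : V × W) :
    (directProd G H).neighborSet x ∩ (directProd G H).neighborSet y =
      (G.neighborSet x.1 ∩ G.neighborSet y.1) ×ˢ (H.neighborSet x.2 ∩ H.neighborSet y.2) := by
  rw [neighborSet_directProd, neighborSet_directProd, Set.prod_inter_prod]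

lemma adj_iso_iff (φ : directProd G H ≃g directProd G H) {x y : V × W} :
    G.Adj (φ x).1 (φ y).1 ∧ H.Adj (φ x).2 (φ y).2 ↔ G.Adj x.1 y.1 ∧ H.Adj x.2 y.2 :=
  φ.map_adj_iff

variable (G H) in
/-- The canonical homomorphism `Aut(G) × Aut(H) → Aut(G × H)`. -/
def prodAut : (G ≃g G) × (H ≃g H) →* (directProd G H ≃g directProd G H) where
  toFun p :=
    { toEquiv := Equiv.prodCongr p.1.toEquiv p.2.toEquiv
      map_rel_iff' := fun {_ _} => and_congr p.1.map_adj_iff p.2.map_adj_iff }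
  map_one' := rfl
  map_mul' _ _ := rfl

lemma prodAut_injective [Nonempty V] [Nonempty W] : Function.Injective (prodAut G H) := by
  intro p q h
  obtain ⟨v⟩ := ‹Nonempty V›
  obtain ⟨w⟩ := ‹Nonempty W›
  have key : ∀ x : V × W, (p.1 x.1, p.2 x.2) = (q.1 x.1, q.2 x.2) := fun x => DFunLike.congr_fun h x
  ext x
  · exact congrArg Prod.fst (key (x, w))
  · exact congrArg Prod.snd (key (v, x))

/-- As the automorphism groups are finite, an abstract isomorphism in the definition of stability
exists only if the canonical embedding is onto. -/
lemma stable_iff_surjective [Finite V] [Finite W] [Nonempty V] [Nonempty W] :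
    Stable G H ↔ Function.Surjective (prodAut G H) := by
  constructor
  · rintro ⟨e⟩
    have : Finite (directProd G H ≃g directProd G H) := DFunLike.finite _
    have hinj : Function.Injective (prodAut G H ∘ e.symm) :=
      prodAut_injective.comp e.symm.injective
    exact ((Finite.injective_iff_surjective.1 hinj).of_comp)
  · exact fun h => ⟨MulEquiv.ofBijective _ ⟨prodAut_injective, h⟩⟩

/-- The automorphism `(u, i) ↦ (α i u, i)` of `G × H` given by an `H`-automorphism `α` of `G`. -/
def IsTupleAut.toIso {α : W → Equiv.Perm V} (hα : IsTupleAut G H α) :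
    directProd G H ≃g directProd G H where
  toFun x := (α x.2 x.1, x.2)
  invFun x := ((α x.2).symm x.1, x.2)
  left_inv x := by simp
  right_inv x := by simp
  map_rel_iff' {x y} := and_congr_left fun h => (hα x.1 y.1 x.2 y.2 h).symm

lemma IsTupleAut.not_stable [Finite V] [Finite W] [Nonempty V] [Nonempty W]
    {α : W → Equiv.Perm V} (hα : IsTupleAut G H α) (hnd : Nondiagonal α) : ¬ Stable G H := by
  rw [stable_iff_surjective]
  intro hs
  obtain ⟨p, hp⟩ := hs hα.toIso
  obtain ⟨i, j, hij⟩ := hnd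
  have key : ∀ v k, p.1 v = α k v := fun v k =>
    congrArg Prod.fst (DFunLike.congr_fun hp (v, k))
  exact hij (Equiv.ext fun v => (key v i).symm.trans (key v j))

end Product

/-! ### Images of pairs at distance two in a fibre -/

section Fibre

variable {V : Type*} {G : SimpleGraph V} {n : ℕ} {C : SimpleGraph (ZMod n)}

/-- In `G × C` the pair `(u, i)`, `(u, i + 2)` has equal degrees, twice the number of common
neighbours. The pairs with this property are the edges of `Γ*` inside a layer and the pairs
`(p, j)`, `(p, j ± 2)`, so automorphisms map `(u, i)`, `(u, i + 2)` to one of these. -/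
lemma image_step [Finite V] (hC : IsResidueCycle C) (hG : RThin G)
    (hpos : ∀ u, (G.neighborSet u).Nonempty) (φ : directProd G C ≃g directProd G C)
    (u : V) (i : ZMod n) :
    ((φ (u, i + 2)).2 = (φ (u, i)).2 ∧ (star G).Adj (φ (u, i)).1 (φ (u, i + 2)).1) ∨
    ((φ (u, i + 2)).1 = (φ (u, i)).1 ∧
      ((φ (u, i + 2)).2 = (φ (u, i)).2 + 2 ∨ (φ (u, i + 2)).2 = (φ (u, i)).2 - 2)) := by
  have := hC.finite
  have hnbr : ∀ x, (directProd G C).neighborSet (φ x) = φ '' (directProd G C).neighborSet x := by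
    intro x
    ext y
    obtain ⟨z, rfl⟩ := φ.surjective y
    simpa using φ.map_adj_iff
  have hdeg : ∀ x : V × ZMod n, (G.neighborSet (φ x).1).ncard = (G.neighborSet x.1).ncard := by
    intro x
    have h := congrArg Set.ncard (hnbr x)
    rw [Set.ncard_image_of_injective _ φ.injective, neighborSet_directProd,
      neighborSet_directProd, Set.ncard_prod, Set.ncard_prod, hC.ncard_neighborSet,
      hC.ncard_neighborSet] at h
    omega
  have hcom : (G.neighborSet (φ (u, i)).1 ∩ G.neighborSet (φ (u, i + 2)).1).ncard *
      (C.neighborSet (φ (u, i)).2 ∩ C.neighborSet (φ (u, i + 2)).2).ncard =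
      (G.neighborSet u).ncard := by
    rw [← Set.ncard_prod, ← inter_neighborSet_directProd, hnbr, hnbr,
      ← Set.image_inter φ.injective, Set.ncard_image_of_injective _ φ.injective,
      inter_neighborSet_directProd, Set.ncard_prod]
    simp [hC.inter_neighborSet]
  have hu : 0 < (G.neighborSet u).ncard := (Set.ncard_pos).2 (hpos u)
  have hne : φ (u, i) ≠ φ (u, i + 2) := by
    intro h
    have := congrArg Prod.snd (φ.injective h)
    simp [hC.two_ne_zero] at this
  have hp : (G.neighborSet (φ (u, i)).1).ncard = _ := hdeg (u, i)
  have hq : (G.neighborSet (φ (u, i + 2)).1).ncard = _ := hdeg (u, i + 2)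
  generalize φ (u, i) = P at *
  generalize φ (u, i + 2) = Q at *
  obtain ⟨p, j⟩ := P
  obtain ⟨q, k⟩ := Q
  dsimp only at *
  -- a single common neighbour in `C` forces equal neighbourhoods in `G`
  have hthin : (C.neighborSet j ∩ C.neighborSet k).ncard = 1 → q = p := by
    intro h1
    rw [h1, mul_one] at hcom
    have h2 : G.neighborSet p ∩ G.neighborSet q = G.neighborSet p :=
      Set.eq_of_subset_of_ncard_le Set.inter_subset_left (by omega)
    have h3 : G.neighborSet p ∩ G.neighborSet q = G.neighborSet q :=
      Set.eq_of_subset_of_ncard_le Set.inter_subset_right (by omega)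
    exact hG _ _ (h3.symm.trans h2)
  by_cases h0 : k = j
  · subst h0
    rw [Set.inter_self, hC.ncard_neighborSet] at hcom
    refine Or.inl ⟨rfl, fun h => hne (by rw [h]), by omega, by omega⟩
  by_cases h1 : k = j + 2
  · refine Or.inr ⟨hthin ?_, Or.inl h1⟩
    rw [h1, hC.inter_neighborSet, Set.ncard_singleton]
  by_cases h2 : k = j - 2
  · refine Or.inr ⟨hthin ?_, Or.inr h2⟩
    have := hC.inter_neighborSet k
    rw [h2, sub_add_cancel] at this
    rw [h2, Set.inter_comm, this, Set.ncard_singleton]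
  · rw [hC.inter_neighborSet_eq_empty h0 h1 h2, Set.ncard_empty, mul_zero] at hcom
    omega

lemma star_common_neighbor [Finite V] (hpos : ∀ u, (G.neighborSet u).Nonempty) {u v : V}
    (h : (star G).Adj u v) : ∃ a, G.Adj u a ∧ G.Adj v a := by
  have hv : 0 < (G.neighborSet v).ncard := (Set.ncard_pos).2 (hpos v)
  have h2 := h.2.2
  have : 0 < (G.neighborSet u ∩ G.neighborSet v).ncard := by omega
  exact (Set.ncard_pos).1 this

/-- The images of `(u, i)`, `(u, i + 2)`, `(u, i + 4)` have no common neighbour. -/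
lemma not_common_image (hC : IsResidueCycle C) (φ : directProd G C ≃g directProd G C)
    {u : V} {i : ZMod n} {z : V × ZMod n} (h0 : (directProd G C).Adj (φ (u, i)) z)
    (h1 : (directProd G C).Adj (φ (u, i + 2)) z) (h2 : (directProd G C).Adj (φ (u, i + 4)) z) :
    False := by
  obtain ⟨y, rfl⟩ := φ.surjective z
  rw [φ.map_adj_iff] at h0 h1 h2
  exact hC.not_common_neighbor h0.2 h1.2 h2.2

/-- A step inside a layer is followed by a step inside the same layer: an edge `{p, q}` of `Γ*` has
a common neighbour `a`, so with `(p, j)`, `(q, j)` and `(q, j ± 2)` would come the common neighbour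
`(a, j ± 1)`. -/
lemma image_step_vertical [Finite V] (hC : IsResidueCycle C) (hG : RThin G)
    (hpos : ∀ u, (G.neighborSet u).Nonempty) (φ : directProd G C ≃g directProd G C)
    {u : V} {i : ZMod n} (h : (φ (u, i + 2)).2 = (φ (u, i)).2) :
    (φ (u, i + 4)).2 = (φ (u, i + 2)).2 := by
  have e : i + 4 = i + 2 + 2 := by ring
  rcases image_step hC hG hpos φ u (i + 2) with h' | ⟨h1, h2⟩
  · rw [e]; exact h'.1
  rcases image_step hC hG hpos φ u i with ⟨h3, h4⟩ | ⟨-, h3⟩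
  · exfalso
    obtain ⟨a, ha, hb⟩ := star_common_neighbor hpos h4
    rw [← e] at h1 h2
    obtain ⟨s, hs⟩ : ∃ s, C.Adj (φ (u, i + 2)).2 s ∧ C.Adj (φ (u, i + 4)).2 s := by
      simp only [hC.adj_iff]
      rcases h2 with h2 | h2
      · exact ⟨(φ (u, i + 2)).2 + 1, Or.inl rfl, Or.inr (by rw [h2]; ring)⟩
      · exact ⟨(φ (u, i + 2)).2 - 1, Or.inr rfl, Or.inl (by rw [h2]; ring)⟩
    refine not_common_image hC φ (z := (a, s)) ⟨ha, ?_⟩ ⟨hb, hs.1⟩ ⟨?_, hs.2⟩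
    · rw [← h]; exact hs.1
    · rw [h1]; exact hb
  · obtain ⟨t, ht, h2, h4⟩ := hC.exists_one
    rw [h] at h3
    grind

lemma image_step_horizontal [Finite V] (hC : IsResidueCycle C) (hG : RThin G)
    (hpos : ∀ u, (G.neighborSet u).Nonempty) (φ : directProd G C ≃g directProd G C)
    {u : V} {i : ZMod n} (h : (φ (u, i + 2)).2 ≠ (φ (u, i)).2) :
    (φ (u, i + 4)).2 ≠ (φ (u, i + 2)).2 := by
  have e : i + 4 = i + 2 + 2 := by ring
  intro h'
  rcases image_step hC hG hpos φ u i with ⟨h3, -⟩ | ⟨h3, h4⟩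
  · exact h h3
  rcases image_step hC hG hpos φ u (i + 2) with ⟨h1, h2⟩ | ⟨-, h2⟩
  · obtain ⟨a, ha, hb⟩ := star_common_neighbor hpos h2
    rw [← e] at h1 hb
    obtain ⟨s, hs⟩ : ∃ s, C.Adj (φ (u, i)).2 s ∧ C.Adj (φ (u, i + 2)).2 s := by
      simp only [hC.adj_iff]
      rcases h4 with h4 | h4
      · exact ⟨(φ (u, i)).2 + 1, Or.inl rfl, Or.inr (by rw [h4]; ring)⟩
      · exact ⟨(φ (u, i)).2 - 1, Or.inr rfl, Or.inl (by rw [h4]; ring)⟩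
    refine not_common_image hC φ (z := (a, s)) ⟨?_, hs.1⟩ ⟨ha, hs.2⟩ ⟨hb, ?_⟩
    · rw [← h3]; exact ha
    · rw [h1]; exact hs.2
  · obtain ⟨t, ht, hh2, hh4⟩ := hC.exists_one
    rw [← e, h'] at h2
    grind

/-- The vertices `(u, i)`, `(u, i + 2)`, … whose images stay in one layer trace out a cycle of
`Γ*`. -/
lemma mem_cycleLengths_of_vertical [Finite V] (hC : IsResidueCycle C) (hG : RThin G)
    (hpos : ∀ u, (G.neighborSet u).Nonempty) (φ : directProd G C ≃g directProd G C)
    (hn : 3 ≤ halfLength n) {u : V} {i : ZMod n} (h : (φ (u, i + 2)).2 = (φ (u, i)).2) :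
    halfLength n ∈ cycleLengths G (φ (u, i)).1 := by
  have e : ∀ k : ℕ, i + 2 * ((k + 1 : ℕ) : ZMod n) = i + 2 * k + 2 := fun k => by push_cast; ring
  have hv : ∀ k : ℕ, (φ (u, i + 2 * k + 2)).2 = (φ (u, i + 2 * k)).2 := by
    intro k
    induction k with
    | zero => simpa using h
    | succ k ih =>
      have := image_step_vertical hC hG hpos φ ih
      rw [e]
      rwa [show i + 2 * (k : ZMod n) + 4 = i + 2 * k + 2 + 2 by ring] at this
  have hc : ∀ k : ℕ, (φ (u, i + 2 * k)).2 = (φ (u, i)).2 := by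
    intro k
    induction k with
    | zero => simp
    | succ k ih => rw [e, hv, ih]
  have := mem_cycleLengths hn (G := G) (fun k : ℕ => (φ (u, i + 2 * k)).1)
    (fun k => by
      simp only [e]
      rcases image_step hC hG hpos φ u (i + 2 * k) with h' | ⟨-, h'⟩
      · exact h'.2
      · obtain ⟨t, ht, h2, h4⟩ := hC.exists_one
        rw [hv] at h'
        grind)
    (fun k l => by
      rw [← two_mul_natCast_eq_iff]
      constructor
      · intro hkl
        have := φ.injective (Prod.ext hkl ((hc k).trans (hc l).symm))
        simpa using congrArg Prod.snd this
      · intro hkl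
        simp only [hkl])
  simpa using this

/-- Horizontal steps continue without turning back. -/
lemma exists_affine_fibre [Finite V] (hC : IsResidueCycle C) (hG : RThin G)
    (hpos : ∀ u, (G.neighborSet u).Nonempty) (φ : directProd G C ≃g directProd G C)
    {u : V} {i : ZMod n} (h : (φ (u, i + 2)).2 ≠ (φ (u, i)).2) :
    ∃ ε c : ZMod n, (ε = 1 ∨ ε = -1) ∧ ∀ x, (φ (u, i + 2 * x)).2 = ε * (i + 2 * x) + c := by
  have e : ∀ k : ℕ, i + 2 * ((k + 1 : ℕ) : ZMod n) = i + 2 * k + 2 := fun k => by push_cast; ring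
  have hh : ∀ k : ℕ, (φ (u, i + 2 * k + 2)).2 ≠ (φ (u, i + 2 * k)).2 := by
    intro k
    induction k with
    | zero => simpa using h
    | succ k ih =>
      have := image_step_horizontal hC hG hpos φ ih
      rw [e]
      rwa [show i + 2 * (k : ZMod n) + 4 = i + 2 * k + 2 + 2 by ring] at this
  have hs : ∀ k : ℕ, (φ (u, i + 2 * k + 2)).1 = (φ (u, i + 2 * k)).1 ∧
      ((φ (u, i + 2 * k + 2)).2 = (φ (u, i + 2 * k)).2 + 2 ∨
        (φ (u, i + 2 * k + 2)).2 = (φ (u, i + 2 * k)).2 - 2) := fun k =>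
    (image_step hC hG hpos φ u (i + 2 * k)).resolve_left fun h' => hh k h'.1
  obtain ⟨ε, hε, h0⟩ : ∃ ε : ZMod n, (ε = 1 ∨ ε = -1) ∧
      (φ (u, i + 2)).2 = (φ (u, i)).2 + ε * 2 := by
    rcases (hs 0).2 with h0 | h0
    · exact ⟨1, Or.inl rfl, by simpa using h0⟩
    · exact ⟨-1, Or.inr rfl, by simpa [sub_eq_add_neg] using h0⟩
  have hstep : ∀ k : ℕ, (φ (u, i + 2 * k + 2)).2 = (φ (u, i + 2 * k)).2 + ε * 2 := by
    intro k
    induction k with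
    | zero => simpa using h0
    | succ k ih =>
      have hb : φ (u, i + 2 * k) ≠ φ (u, i + 2 * (k + 1 : ℕ) + 2) := by
        intro h'
        have := congrArg Prod.snd (φ.injective h')
        apply hC.four_ne_zero
        push_cast at this
        linear_combination -this
      have h1 := hs k
      have h2 := hs (k + 1)
      rw [e] at h2 hb ⊢
      have h3 : (φ (u, i + 2 * k + 2 + 2)).2 ≠ (φ (u, i + 2 * k)).2 := fun h3 =>
        hb (Prod.ext (h2.1.trans h1.1).symm h3.symm)
      generalize (φ (u, i + 2 * k + 2 + 2)).2 = z at *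
      generalize (φ (u, i + 2 * k + 2)).2 = y at *
      generalize (φ (u, i + 2 * k)).2 = x at *
      grind
  refine ⟨ε, (φ (u, i)).2 - ε * i, hε, fun x => ?_⟩
  obtain ⟨k, rfl⟩ := hC.exists_natCast x
  induction k with
  | zero => simp
  | succ k ih =>
    rw [e, hstep, ih]
    ring

end Fibre

/-! ### Automorphisms that act on the cycle -/

section Rigid

variable {V : Type*} {G : SimpleGraph V} {n : ℕ} {C : SimpleGraph (ZMod n)}

/-- If the second coordinate of `φ` is affine on one class `i + 2ℤ` of a fibre, it is so
everywhere: for a neighbour `w` of `v`, the vertex `(w, x + 1)` is a common neighbour of `(v, x)` and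
`(v, x + 2)`, whose images leave one choice for its second coordinate; and `Γ × Cₙ` is connected. -/
lemma affine_everywhere (hC : IsResidueCycle C) (hconn : G.Connected)
    (hbip : ¬ G.IsBipartite ∨ Odd n) (φ : directProd G C ≃g directProd G C)
    {u : V} {i ε c : ZMod n} (hε : ε = 1 ∨ ε = -1)
    (h : ∀ x, (φ (u, i + 2 * x)).2 = ε * (i + 2 * x) + c) :
    ∀ v x, (φ (v, x)).2 = ε * x + c := by
  let Q : V → ZMod n → Prop := fun v y => ∀ x, (φ (v, y + 2 * x)).2 = ε * (y + 2 * x) + c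
  have hQ2 : ∀ v y z, Q v y → Q v (y + 2 * z) := by
    intro v y z hv x
    rw [add_assoc, ← mul_add]
    exact hv _
  have hQ1 : ∀ v w y, G.Adj v w → Q v y → Q w (y + 1) := by
    intro v w y hvw hv x
    have h1 : C.Adj (φ (v, y + 2 * x)).2 (φ (w, y + 1 + 2 * x)).2 :=
      ((adj_iso_iff φ).2 ⟨hvw, (hC.adj_iff _ _).2 (Or.inl (by ring))⟩).2
    have h2 : C.Adj (φ (v, y + 2 * (x + 1))).2 (φ (w, y + 1 + 2 * x)).2 :=
      ((adj_iso_iff φ).2 ⟨hvw, (hC.adj_iff _ _).2 (Or.inr (by ring))⟩).2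
    rw [hv, hC.adj_iff] at h1 h2
    obtain ⟨t, ht, hh2, hh4⟩ := hC.exists_one
    generalize (φ (w, y + 1 + 2 * x)).2 = z at *
    rcases hε with rfl | rfl <;> grind
  -- the sets of vertices over which `φ` is affine on the class of `i` and of `i + 1`
  have hA : ∀ v w, G.Adj v w → Q v i → Q w (i + 1) := fun v w hvw hv => hQ1 v w i hvw hv
  have hB : ∀ v w, G.Adj v w → Q v (i + 1) → Q w i := fun v w hvw hv => by
    have := hQ2 _ _ (-1) (hQ1 v w (i + 1) hvw hv)
    rwa [show i + 1 + 1 + 2 * (-1) = i by ring] at this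
  have hor : ∀ v, Q v i ∨ Q v (i + 1) := by
    intro v
    obtain ⟨p⟩ := hconn.preconnected u v
    have hu : Q u i ∨ Q u (i + 1) := Or.inl h
    clear h
    induction p with
    | nil => exact hu
    | cons hadj _ ih =>
      exact ih (hu.elim (fun h => Or.inr (hA _ _ hadj h)) fun h => Or.inl (hB _ _ hadj h))
  have hex : ∃ v, Q v i ∧ Q v (i + 1) := by
    by_contra hno
    push Not at hno
    rcases hbip with hbip | hodd
    · classical
      refine hbip ⟨SimpleGraph.Coloring.mk (fun v => if Q v i then (0 : Fin 2) else 1) ?_⟩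
      intro v w hvw
      by_cases hv : Q v i
      · have : ¬ Q w i := fun hw => hno w hw (hA v w hvw hv)
        simp [hv, this]
      · have : Q w i := hB v w hvw ((hor v).resolve_left hv)
        simp [hv, this]
    · obtain ⟨y, hy⟩ := exists_two_mul_eq hodd (1 : ZMod n)
      exact hno u h (by rw [hy]; exact hQ2 u i y h)
  have hall : ∀ v, Q v i ∧ Q v (i + 1) := by
    intro v
    obtain ⟨w, hw⟩ := hex
    obtain ⟨p⟩ := hconn.preconnected w v
    clear h
    induction p with
    | nil => exact hw
    | cons hadj _ ih => exact ih ⟨hB _ _ hadj hw.2, hA _ _ hadj hw.1⟩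
  intro v x
  obtain ⟨k, hk⟩ := hC.exists_natCast (x - i)
  obtain ⟨l, rfl | rfl⟩ := Nat.even_or_odd' k
  · have := (hall v).1 l
    rwa [show i + 2 * (l : ZMod n) = x by push_cast at hk; linear_combination hk] at this
  · have := (hall v).2 l
    rwa [show i + 1 + 2 * (l : ZMod n) = x by push_cast at hk; linear_combination hk] at this

/-- An automorphism acting affinely on the second coordinate yields a `C`-automorphism of `G`; if
this is diagonal, the automorphism is a product. -/
lemma mem_range_of_affine [Finite V] (hC : IsResidueCycle C)
    (hdiag : ∀ α : ZMod n → Equiv.Perm V, IsTupleAut G C α → ¬ Nondiagonal α)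
    (φ : directProd G C ≃g directProd G C) {ε c : ZMod n} (hε : ε = 1 ∨ ε = -1)
    (h : ∀ v x, (φ (v, x)).2 = ε * x + c) : φ ∈ (prodAut G C).range := by
  have hε2 : ε * ε = 1 := by rcases hε with rfl | rfl <;> ring
  have hinj : ∀ x, Function.Injective fun v => (φ (v, x)).1 := by
    intro x v w hvw
    have := φ.injective (Prod.ext hvw ((h v x).trans (h w x).symm))
    exact congrArg Prod.fst this
  let α : ZMod n → Equiv.Perm V := fun x =>
    Equiv.ofBijective _ (Finite.injective_iff_bijective.1 (hinj x))
  have hα : ∀ x v, α x v = (φ (v, x)).1 := fun x v => rfl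
  let e : ZMod n ≃ ZMod n :=
    { toFun := fun x => ε * x + c
      invFun := fun x => ε * (x - c)
      left_inv := fun x => by linear_combination x * hε2
      right_inv := fun x => by linear_combination (x - c) * hε2 }
  have he : ∀ x y, C.Adj (e x) (e y) ↔ C.Adj x y := by
    intro x y
    simp only [hC.adj_iff, e, Equiv.coe_fn_mk]
    rcases hε with rfl | rfl
    · constructor <;> rintro (h | h)
      · exact Or.inl (by linear_combination h)
      · exact Or.inr (by linear_combination h)
      · exact Or.inl (by linear_combination h)
      · exact Or.inr (by linear_combination h)
    · constructor <;> rintro (h | h)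
      · exact Or.inr (by linear_combination -h)
      · exact Or.inl (by linear_combination -h)
      · exact Or.inr (by linear_combination -h)
      · exact Or.inl (by linear_combination -h)
  have hφ : ∀ v x, φ (v, x) = (α x v, e x) := fun v x => Prod.ext rfl (h v x)
  have htuple : IsTupleAut G C α := by
    intro u v i j hij
    have := adj_iso_iff φ (x := (u, i)) (y := (v, j))
    simp only [hφ, he] at this
    tauto
  have hconst : ∀ x, α x = α 0 := by
    have := hdiag α htuple
    unfold Nondiagonal at this
    push Not at this
    exact fun x => this x 0
  let g : G ≃g G := ⟨α 0, fun {u v} => by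
    have := htuple u v 0 1 ((hC.adj_iff _ _).2 (Or.inl (by ring)))
    rw [hconst 1] at this
    exact this.symm⟩
  refine ⟨(g, ⟨e, fun {x y} => he x y⟩), ?_⟩
  ext1 ⟨v, x⟩
  rw [hφ, hconst]
  rfl

/-- For compatible `n`, an automorphism whose steps are all vertical would give a cycle of `Γ*` of
the excluded length through every vertex. -/
lemma mem_range_of_compatible [Finite V] (hC : IsResidueCycle C) (hG : RThin G)
    (hconn : G.Connected) (hpos : ∀ u, (G.neighborSet u).Nonempty)
    (hbip : ¬ G.IsBipartite ∨ Odd n) (hn : 3 ≤ halfLength n)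
    (hdiag : ∀ α : ZMod n → Equiv.Perm V, IsTupleAut G C α → ¬ Nondiagonal α)
    (hcomp : Compatible n G) (φ : directProd G C ≃g directProd G C) :
    φ ∈ (prodAut G C).range := by
  obtain ⟨v, hv⟩ := compatible_iff.1 hcomp
  obtain ⟨⟨u, i⟩, hu⟩ := φ.surjective (v, 0)
  have h : (φ (u, i + 2)).2 ≠ (φ (u, i)).2 := by
    intro h
    have := mem_cycleLengths_of_vertical hC hG hpos φ hn h
    rw [hu] at this
    exact hv this
  obtain ⟨ε, c, hε, h⟩ := exists_affine_fibre hC hG hpos φ h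
  exact mem_range_of_affine hC hdiag φ hε (affine_everywhere hC hconn hbip φ hε h)

/-- For odd `n`, if `φ` and its inverse `ψ` have only vertical steps, then each fibre is mapped by
`ψ` into a layer. An edge `{a, b}` among the common neighbours of the images of `(u, 0)` and
`(u, 2)` then gives two fibres mapped into the same layer, which is impossible as there are edges
between the fibres but not inside the layer. -/
lemma mem_range_of_not_isIndepSet [Finite V] [Nonempty V] (hC : IsResidueCycle C) (hG : RThin G)
    (hconn : G.Connected) (hpos : ∀ u, (G.neighborSet u).Nonempty) (hn : Odd n)
    (hdiag : ∀ α : ZMod n → Equiv.Perm V, IsTupleAut G C α → ¬ Nondiagonal α)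
    (hind : ∀ u v, (star G).Adj u v → ¬ G.IsIndepSet (G.neighborSet u ∩ G.neighborSet v))
    (φ : directProd G C ≃g directProd G C) : φ ∈ (prodAut G C).range := by
  have hgood : ∀ φ : directProd G C ≃g directProd G C, ∀ u i,
      (φ (u, i + 2)).2 ≠ (φ (u, i)).2 → φ ∈ (prodAut G C).range := by
    intro φ u i h
    obtain ⟨ε, c, hε, h⟩ := exists_affine_fibre hC hG hpos φ h
    exact mem_range_of_affine hC hdiag φ hε (affine_everywhere hC hconn (Or.inr hn) φ hε h)
  by_contra hno
  have hφ : ∀ u i, (φ (u, i + 2)).2 = (φ (u, i)).2 := fun u i => by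
    by_contra h
    exact hno (hgood φ u i h)
  let ψ := φ.symm
  have hψ : ∀ u i, (ψ (u, i + 2)).2 = (ψ (u, i)).2 := fun u i => by
    by_contra h
    have : φ⁻¹ ∈ (prodAut G C).range := hgood ψ u i h
    exact hno ((Subgroup.inv_mem_iff _).1 this)
  have hlayer : ∀ a x, (ψ (a, x)).2 = (ψ (a, 0)).2 := by
    intro a x
    obtain ⟨y, rfl⟩ := exists_two_mul_eq hn x
    obtain ⟨k, rfl⟩ := hC.exists_natCast y
    induction k with
    | zero => simp
    | succ k ih =>
      rw [← ih, ← hψ a (2 * k)]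
      push_cast
      ring_nf
  obtain ⟨u⟩ := ‹Nonempty V›
  obtain ⟨h1, h2⟩ : (φ (u, 0 + 2)).2 = (φ (u, 0)).2 ∧
      (star G).Adj (φ (u, 0)).1 (φ (u, 0 + 2)).1 := by
    rcases image_step hC hG hpos φ u 0 with h | ⟨-, h⟩
    · exact h
    · obtain ⟨t, ht, h2, h4⟩ := hC.exists_one
      have := hφ u 0
      rw [this] at h
      grind
  have h3 := hind _ _ h2
  rw [SimpleGraph.isIndepSet_iff] at h3
  obtain ⟨a, ha, b, hb, hab⟩ :
      ∃ a, a ∈ G.neighborSet (φ (u, 0)).1 ∩ G.neighborSet (φ (u, 0 + 2)).1 ∧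
      ∃ b, b ∈ G.neighborSet (φ (u, 0)).1 ∩ G.neighborSet (φ (u, 0 + 2)).1 ∧ G.Adj a b := by
    unfold Set.Pairwise at h3
    push Not at h3
    obtain ⟨a, ha, b, hb, -, hab⟩ := h3
    exact ⟨a, ha, b, hb, hab⟩
  have hone : ∀ a, a ∈ G.neighborSet (φ (u, 0)).1 ∩ G.neighborSet (φ (u, 0 + 2)).1 →
      (ψ (a, 0)).2 = 1 := by
    intro a ha
    rw [← hlayer a ((φ (u, 0)).2 + 1)]
    have hadj : ∀ i, (φ (u, i)).2 = (φ (u, 0)).2 → G.Adj (φ (u, i)).1 a →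
        C.Adj i (ψ (a, (φ (u, 0)).2 + 1)).2 := by
      intro i hi hia
      have h : (directProd G C).Adj (φ (u, i)) (a, (φ (u, 0)).2 + 1) :=
        ⟨hia, (hC.adj_iff _ _).2 (Or.inl (by rw [hi]))⟩
      have := ψ.map_adj_iff.2 h
      simp only [ψ, RelIso.symm_apply_apply] at this
      exact this.2
    have hmem : (ψ (a, (φ (u, 0)).2 + 1)).2 ∈ C.neighborSet 0 ∩ C.neighborSet (0 + 2) :=
      ⟨hadj 0 rfl ha.1, hadj _ h1 ha.2⟩
    rw [hC.inter_neighborSet] at hmem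
    simpa using hmem
  have hcontra : C.Adj (ψ (a, 0)).2 (ψ (b, 1)).2 :=
    ((adj_iso_iff ψ).2 ⟨hab, (hC.adj_iff _ _).2 (Or.inl (by ring))⟩).2
  rw [hlayer b, hone a ha, hone b hb] at hcontra
  exact hcontra.ne rfl

end Rigid

/-! ### Common direct factors with a cycle -/

section Coprime

variable {V A B D : Type*} {G : SimpleGraph V} {n : ℕ} {C : SimpleGraph (ZMod n)}
  {G' : LoopGraph A} {H' : LoopGraph B} {K : LoopGraph D}

lemma LoopCoprime.coprime {V W : Type*} {G : SimpleGraph V} {H : SimpleGraph W}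
    (h : LoopCoprime G H) : Coprime G H := by
  rintro ⟨A, B, D, G', H', K, hA, hB, hD, hDn, ⟨σ⟩, ⟨τ⟩⟩
  exact h ⟨A, B, D, ⟨G'.Adj, fun _ _ => G'.symm.symm _ _⟩, ⟨H'.Adj, fun _ _ => H'.symm.symm _ _⟩,
    ⟨K.Adj, fun _ _ => K.symm.symm _ _⟩, hA, hB, hD, hDn, ⟨σ⟩, ⟨τ⟩⟩

/-- Every vertex has at most one neighbour. -/
def LoopGraph.IsMatching {D : Type*} (K : LoopGraph D) : Prop :=
  ∀ d e e', K.Adj d e → K.Adj d e' → e = e'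

lemma factor_step (hC : IsResidueCycle C) (σ : C.Adj ≃r (H'.directProd K).Adj) (i : ZMod n) :
    H'.Adj (σ i).1 (σ (i + 1)).1 ∧ K.Adj (σ i).2 (σ (i + 1)).2 :=
  σ.map_rel_iff.2 ((hC.adj_iff _ _).2 (Or.inl rfl))

lemma factor_neighbor (hC : IsResidueCycle C) (σ : C.Adj ≃r (H'.directProd K).Adj) {i : ZMod n}
    {b : B} {d : D} (hb : H'.Adj (σ i).1 b) (hd : K.Adj (σ i).2 d) :
    σ (i + 1) = (b, d) ∨ σ (i - 1) = (b, d) := by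
  obtain ⟨j, hj⟩ := σ.surjective (b, d)
  have h : (H'.directProd K).Adj (σ i) (σ j) := by rw [hj]; exact ⟨hb, hd⟩
  rcases (hC.adj_iff _ _).1 (σ.map_rel_iff.1 h) with rfl | rfl
  · exact Or.inl hj
  · exact Or.inr hj

/-- As the degrees of the factors multiply to `2`, one of the factors has degree `1` throughout. -/
lemma isMatching_or_isMatching (hC : IsResidueCycle C) (σ : C.Adj ≃r (H'.directProd K).Adj) :
    H'.IsMatching ∨ K.IsMatching := by
  by_contra hno
  unfold LoopGraph.IsMatching at hno
  push Not at hno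
  obtain ⟨⟨b, y, y', hy, hy', hyy⟩, ⟨d, z, z', hz, hz', hzz⟩⟩ := hno
  obtain ⟨l, hl⟩ := σ.surjective (b, d)
  have hb : (σ l).1 = b := by rw [hl]
  have hd : (σ l).2 = d := by rw [hl]
  have h1 := factor_neighbor hC σ (hb ▸ hy) (hd ▸ hz)
  have h2 := factor_neighbor hC σ (hb ▸ hy) (hd ▸ hz')
  have h3 := factor_neighbor hC σ (hb ▸ hy') (hd ▸ hz)
  grind

/-- If `K` has degree `1`, it is `K₂`, so every graph mapping to it is bipartite. -/
lemma isBipartite_of_isMatching [Nontrivial D] (hC : IsResidueCycle C)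
    (σ : C.Adj ≃r (H'.directProd K).Adj) (hK : K.IsMatching) {U : Type*} {F : SimpleGraph U}
    (f : U → D) (hf : ∀ u v, F.Adj u v → K.Adj (f u) (f v)) : F.IsBipartite := by
  have hstep : ∀ i, (σ (i + 1 + 1)).2 = (σ i).2 := fun i =>
    hK _ _ _ (factor_step hC σ (i + 1)).2 (K.symm _ _ (factor_step hC σ i).2)
  have hall : ∀ d, d = (σ 0).2 ∨ d = (σ 1).2 := by
    intro d
    obtain ⟨b⟩ : Nonempty B := ⟨(σ 0).1⟩
    obtain ⟨i, hi⟩ := σ.surjective (b, d)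
    have hd : d = (σ i).2 := by rw [hi]
    obtain ⟨k, rfl⟩ := hC.exists_natCast i
    have key : ∀ k : ℕ, ((σ (k : ZMod n)).2 = (σ 0).2 ∧ (σ ((k : ZMod n) + 1)).2 = (σ 1).2) ∨
        ((σ (k : ZMod n)).2 = (σ 1).2 ∧ (σ ((k : ZMod n) + 1)).2 = (σ 0).2) := by
      intro k
      induction k with
      | zero => simp
      | succ k ih =>
        push_cast
        rw [hstep]
        tauto
    rw [hd]
    rcases key k with h | h
    · exact Or.inl h.1
    · exact Or.inr h.1
  have hne : (σ 0).2 ≠ (σ 1).2 := by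
    intro h
    obtain ⟨d, e, hde⟩ := exists_pair_ne D
    rcases hall d with rfl | rfl <;> rcases hall e with rfl | rfl <;> simp_all
  have h01 : K.Adj (σ 0).2 (σ 1).2 := by simpa using (factor_step hC σ 0).2
  classical
  refine ⟨SimpleGraph.Coloring.mk (fun u => if f u = (σ 0).2 then (0 : Fin 2) else 1) ?_⟩
  intro u v huv
  have h := hf u v huv
  rcases hall (f u) with h0 | h0
  · rw [h0] at h
    have h1 := hK _ _ _ h h01
    simp [h0, h1, hne.symm]
  · rw [h0] at h
    have h1 := hK _ _ _ h (K.symm _ _ h01)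
    simp [h0, h1, hne.symm]

lemma factor_fst_eq (hC : IsResidueCycle C) (σ : C.Adj ≃r (H'.directProd K).Adj)
    (hH : H'.IsMatching) (i x : ZMod n) : (σ (i + 2 * x)).1 = (σ i).1 := by
  obtain ⟨k, rfl⟩ := hC.exists_natCast x
  induction k with
  | zero => simp
  | succ k ih =>
    rw [← ih]
    have := hH _ _ _ (factor_step hC σ (i + 2 * k + 1)).1
      (H'.symm _ _ (factor_step hC σ (i + 2 * k)).1)
    rw [← this]
    push_cast
    ring_nf

lemma factor_snd_eq_iff (hC : IsResidueCycle C) (σ : C.Adj ≃r (H'.directProd K).Adj)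
    (hH : H'.IsMatching) (i x y : ZMod n) :
    (σ (i + 2 * x)).2 = (σ (i + 2 * y)).2 ↔ 2 * x = 2 * y := by
  constructor
  · intro h
    have := σ.injective (Prod.ext
      ((factor_fst_eq hC σ hH i x).trans (factor_fst_eq hC σ hH i y).symm) h)
    exact add_left_cancel this
  · intro h
    rw [h]

lemma factor_neighborSet (hC : IsResidueCycle C) (σ : C.Adj ≃r (H'.directProd K).Adj) (i : ZMod n) :
    {e | K.Adj (σ i).2 e} = {(σ (i + 1)).2, (σ (i - 1)).2} := by
  ext e
  simp only [Set.mem_ofPred_eq, Set.mem_insert_iff, Set.mem_singleton_iff]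
  constructor
  · intro h
    rcases factor_neighbor hC σ (factor_step hC σ i).1 h with h | h
    · exact Or.inl (by rw [h])
    · exact Or.inr (by rw [h])
  · rintro (rfl | rfl)
    · exact (factor_step hC σ i).2
    · have := (factor_step hC σ (i - 1)).2
      rw [sub_add_cancel] at this
      exact K.symm _ _ this

lemma factor_ncard_neighborSet (hC : IsResidueCycle C) (σ : C.Adj ≃r (H'.directProd K).Adj)
    (hH : H'.IsMatching) (i : ZMod n) : {e | K.Adj (σ i).2 e}.ncard = 2 := by
  rw [factor_neighborSet hC σ, Set.ncard_pair]
  have := factor_snd_eq_iff hC σ hH (i - 1) 1 0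
  rw [show i - 1 + 2 * 1 = i + 1 by ring, show i - 1 + 2 * 0 = i - 1 by ring] at this
  rw [Ne, this]
  simpa using hC.two_ne_zero

lemma factor_inter_neighborSet (hC : IsResidueCycle C) (σ : C.Adj ≃r (H'.directProd K).Adj)
    (hH : H'.IsMatching) (i : ZMod n) :
    {e | K.Adj (σ i).2 e} ∩ {e | K.Adj (σ (i + 2)).2 e} = {(σ (i + 1)).2} := by
  have h1 := factor_snd_eq_iff hC σ hH (i - 1) 1 0
  have h2 := factor_snd_eq_iff hC σ hH (i - 1) 2 0
  rw [show i - 1 + 2 * 1 = i + 1 by ring, show i - 1 + 2 * 0 = i - 1 by ring] at h1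
  rw [show i - 1 + 2 * 2 = i + 3 by ring, show i - 1 + 2 * 0 = i - 1 by ring] at h2
  rw [factor_neighborSet hC σ, factor_neighborSet hC σ,
    show i + 2 + 1 = i + 3 by ring, show i + 2 - 1 = i + 1 by ring]
  obtain ⟨t, ht, hh2, hh4⟩ := hC.exists_one
  ext e
  simp only [Set.mem_inter_iff, Set.mem_insert_iff, Set.mem_singleton_iff]
  grind

lemma inter_neighborSet_symm (τ : G.Adj ≃r (G'.directProd K).Adj) (x y : A × D) :
    G.neighborSet (τ.symm x) ∩ G.neighborSet (τ.symm y) =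
      τ.symm '' (({a | G'.Adj x.1 a} ∩ {a | G'.Adj y.1 a}) ×ˢ
        ({e | K.Adj x.2 e} ∩ {e | K.Adj y.2 e})) := by
  ext u
  obtain ⟨z, rfl⟩ := τ.symm.surjective u
  have h : ∀ w, G.Adj (τ.symm w) (τ.symm z) ↔ G'.Adj w.1 z.1 ∧ K.Adj w.2 z.2 :=
    fun w => τ.symm.map_rel_iff
  rw [Function.Injective.mem_set_image τ.symm.injective]
  simp only [Set.mem_inter_iff, SimpleGraph.mem_neighborSet, h, Set.mem_prod, Set.mem_ofPred_eq]
  tauto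

/-- The pairs `(g, v)`, `(g, w)` with `v`, `w` at distance two in the factor `K` are edges of
`Γ*`. -/
lemma star_adj_factor (hC : IsResidueCycle C) (σ : C.Adj ≃r (H'.directProd K).Adj)
    (hH : H'.IsMatching) (τ : G.Adj ≃r (G'.directProd K).Adj) (g : A) (i : ZMod n) :
    (star G).Adj (τ.symm (g, (σ i).2)) (τ.symm (g, (σ (i + 2)).2)) := by
  have hdeg : ∀ i, (G.neighborSet (τ.symm (g, (σ i).2))).ncard = {a | G'.Adj g a}.ncard * 2 := by
    intro i
    have := inter_neighborSet_symm τ (g, (σ i).2) (g, (σ i).2)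
    rw [Set.inter_self, Set.inter_self, Set.inter_self] at this
    rw [this, Set.ncard_image_of_injective _ τ.symm.injective, Set.ncard_prod,
      factor_ncard_neighborSet hC σ hH]
  refine ⟨fun h => ?_, (hdeg _).trans (hdeg _).symm, ?_⟩
  · have h1 := congrArg Prod.snd (τ.symm.injective h)
    have h2 := factor_snd_eq_iff hC σ hH i 0 1
    simp only [mul_zero, add_zero, mul_one] at h2
    exact hC.two_ne_zero (h2.1 h1).symm
  · rw [hdeg, inter_neighborSet_symm, Set.ncard_image_of_injective _ τ.symm.injective,
      Set.ncard_prod]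
    dsimp only
    rw [Set.inter_self, factor_inter_neighborSet hC σ hH, Set.ncard_singleton]
    omega

/-- A common factor with the cycle forces a cycle of `Γ*` of length `n` or `n / 2` through every
vertex, and for odd `n` also edges of `Γ*` whose ends have an independent set of common
neighbours. -/
lemma of_not_loopCoprime [Finite V] [Nonempty V] (hC : IsResidueCycle C)
    (hn : 3 ≤ halfLength n) (hbip : ¬ G.IsBipartite ∨ ¬ C.IsBipartite)
    (h : ¬ LoopCoprime G C) :
    (∀ u, halfLength n ∈ cycleLengths G u) ∧
      (Odd n → ∃ u v, (star G).Adj u v ∧ G.IsIndepSet (G.neighborSet u ∩ G.neighborSet v)) := by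
  obtain ⟨A, B, D, G', H', K, -, -, -, hDn, ⟨τ⟩, ⟨σ⟩⟩ := not_not.1 h
  rcases isMatching_or_isMatching hC σ with hH | hK
  swap
  · exfalso
    have h1 : G.IsBipartite := isBipartite_of_isMatching hC σ hK (fun u => (τ u).2)
      fun u v huv => (τ.map_rel_iff.2 huv).2
    have h2 : C.IsBipartite := isBipartite_of_isMatching hC σ hK (fun u => (σ u).2)
      fun u v huv => (σ.map_rel_iff.2 huv).2
    tauto
  constructor
  · intro u
    obtain ⟨⟨g, d⟩, rfl⟩ := τ.symm.surjective u
    obtain ⟨i, hi⟩ := σ.surjective ((σ 0).1, d)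
    have hd : (σ i).2 = d := by rw [hi]
    have := mem_cycleLengths hn (G := G) (fun k : ℕ => τ.symm (g, (σ (i + 2 * k)).2))
      (fun k => by
        have := star_adj_factor hC σ hH τ g (i + 2 * k)
        rw [show i + 2 * (k : ZMod n) + 2 = i + 2 * ((k + 1 : ℕ) : ZMod n) by push_cast; ring]
          at this
        exact this)
      (fun k l => by
        rw [← two_mul_natCast_eq_iff, ← factor_snd_eq_iff hC σ hH i, τ.symm.injective.eq_iff]
        simp)
    simpa [hd] using this
  · intro ho
    obtain ⟨u⟩ := ‹Nonempty V›
    refine ⟨_, _, star_adj_factor hC σ hH τ (τ u).1 0, ?_⟩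
    rw [inter_neighborSet_symm, SimpleGraph.isIndepSet_iff]
    rintro _ ⟨⟨a, d⟩, ⟨-, hd⟩, rfl⟩ _ ⟨⟨b, e⟩, ⟨-, he⟩, rfl⟩ -
    dsimp only at hd he
    rw [factor_inter_neighborSet hC σ hH] at hd he
    rw [Set.mem_singleton_iff.1 hd, Set.mem_singleton_iff.1 he]
    intro hadj
    have hK : K.Adj (σ (0 + 1)).2 (σ (0 + 1)).2 := (τ.symm.map_rel_iff.1 hadj).2
    -- for odd `n` the other coordinate is constant, so it is a loop of `H'`
    obtain ⟨y, hy⟩ := exists_two_mul_eq ho (1 : ZMod n)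
    have hH1 := (factor_step hC σ (0 + 1)).1
    have h2 := factor_fst_eq hC σ hH (0 + 1) y
    rw [← hy] at h2
    rw [h2] at hH1
    have : C.Adj (0 + 1) (0 + 1) := σ.map_rel_iff.1 ⟨hH1, hK⟩
    exact this.ne rfl

end Coprime

/-! ### Nontrivial instability -/

/-- For a coprime pair, both equivalences reduce to the surjectivity of the canonical embedding when
all tuples are diagonal. -/
lemma nontriviallyUnstable_iff {V : Type*} [Finite V] [Nonempty V] {G : SimpleGraph V} {n : ℕ}
    {C : SimpleGraph (ZMod n)} (hC : IsResidueCycle C) (hCc : C.Connected) (hG : RThin G)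
    (hconn : G.Connected) (hbip : ¬ G.IsBipartite ∨ ¬ C.IsBipartite) (hcop : LoopCoprime G C)
    (hsurj : (∀ α : ZMod n → Equiv.Perm V, IsTupleAut G C α → ¬ Nondiagonal α) →
      ∀ φ, φ ∈ (prodAut G C).range) :
    (NontriviallyUnstable G C ↔
        ∃ α : ZMod n → Equiv.Perm V, IsTupleAut G C α ∧ Nondiagonal α) ∧
      (LoopNontriviallyUnstable G C ↔
        ∃ α : ZMod n → Equiv.Perm V, IsTupleAut G C α ∧ Nondiagonal α) := by
  have := hC.finite
  have hst : ¬ Stable G C ↔ ∃ α : ZMod n → Equiv.Perm V, IsTupleAut G C α ∧ Nondiagonal α := by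
    constructor
    · contrapose!
      intro h
      exact stable_iff_surjective.2 (hsurj h)
    · rintro ⟨α, hα, hnd⟩
      exact hα.not_stable hnd
  constructor
  · rw [← hst]
    exact ⟨fun h => h.1, fun h => ⟨h, hG, hC.rThin, hconn, hCc, hcop.coprime, hbip⟩⟩
  · rw [← hst]
    exact ⟨fun h => h.1, fun h => ⟨h, hG, hC.rThin, hconn, hCc, hcop, hbip⟩⟩

lemma three_le_halfLength {n : ℕ} (hn : 3 ≤ n) (hn4 : n ≠ 4) : 3 ≤ halfLength n := by
  unfold halfLength
  split_ifs with h
  · exact hn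
  · rw [Nat.not_odd_iff_even] at h
    obtain ⟨m, rfl⟩ := h
    omega

/-- On `Fin n`, which is `ZMod n` for positive `n`, Mathlib's cycle graph is a residue cycle. -/
lemma isResidueCycle_cycleGraph {m : ℕ} (hm : m + 3 ≠ 4) :
    IsResidueCycle (n := m + 3) (SimpleGraph.cycleGraph (m + 3)) := by
  refine ⟨by omega, hm, fun i j => ?_⟩
  refine SimpleGraph.cycleGraph_adj.trans ?_
  change i - j = 1 ∨ j - i = 1 ↔ _
  constructor <;> rintro (h | h)
  · exact Or.inr (by linear_combination -h)
  · exact Or.inl (by linear_combination h)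
  · exact Or.inr (by linear_combination h)
  · exact Or.inl (by linear_combination -h)

end GraphPair

theorem theorem1p1 {V : Type*} [Finite V] [Nontrivial V] (Γ : SimpleGraph V)
    (hthin : GraphPair.RThin Γ) (hconn : Γ.Connected)
    (n : ℕ) (hn : 3 ≤ n) (hn4 : n ≠ 4)
    (hbip : ¬ Γ.IsBipartite ∨ ¬ (SimpleGraph.cycleGraph n).IsBipartite) :
    (GraphPair.Compatible n Γ →
      ((GraphPair.NontriviallyUnstable Γ (SimpleGraph.cycleGraph n) ↔
        ∃ α : Fin n → Equiv.Perm V,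
          GraphPair.IsTupleAut Γ (SimpleGraph.cycleGraph n) α ∧ GraphPair.Nondiagonal α) ∧
      (GraphPair.LoopNontriviallyUnstable Γ (SimpleGraph.cycleGraph n) ↔
        ∃ α : Fin n → Equiv.Perm V,
          GraphPair.IsTupleAut Γ (SimpleGraph.cycleGraph n) α ∧ GraphPair.Nondiagonal α))) ∧
    (5 ≤ n → Odd n →
      (∀ u v : V, (GraphPair.star Γ).Adj u v →
        ¬ Γ.IsIndepSet (Γ.neighborSet u ∩ Γ.neighborSet v)) →
      ((GraphPair.NontriviallyUnstable Γ (SimpleGraph.cycleGraph n) ↔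
        ∃ α : Fin n → Equiv.Perm V,
          GraphPair.IsTupleAut Γ (SimpleGraph.cycleGraph n) α ∧ GraphPair.Nondiagonal α) ∧
      (GraphPair.LoopNontriviallyUnstable Γ (SimpleGraph.cycleGraph n) ↔
        ∃ α : Fin n → Equiv.Perm V,
          GraphPair.IsTupleAut Γ (SimpleGraph.cycleGraph n) α ∧ GraphPair.Nondiagonal α))) := by
  have hpos : ∀ u, (Γ.neighborSet u).Nonempty := fun u =>
    hconn.preconnected.exists_adj_of_nontrivial u
  have hhalf := GraphPair.three_le_halfLength hn hn4
  have hbip' : ¬ Γ.IsBipartite ∨ Odd n := by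
    rcases hbip with h | h
    · exact Or.inl h
    · refine Or.inr (Nat.not_even_iff_odd.1 fun he => h ?_)
      simpa using (SimpleGraph.cycleGraph.bicoloring_of_even n he).colorable
  obtain ⟨m, rfl⟩ : ∃ m, n = m + 3 := ⟨n - 3, by omega⟩
  have hC := GraphPair.isResidueCycle_cycleGraph hn4
  have hCc : (SimpleGraph.cycleGraph (m + 3)).Connected := SimpleGraph.cycleGraph_connected
  constructor
  · intro hcomp
    refine GraphPair.nontriviallyUnstable_iff hC hCc hthin hconn hbip ?_ fun hdiag φ =>
      GraphPair.mem_range_of_compatible hC hthin hconn hpos hbip' hhalf hdiag hcomp φ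
    by_contra hcop
    obtain ⟨u, hu⟩ := GraphPair.compatible_iff.1 hcomp
    exact hu ((GraphPair.of_not_loopCoprime hC hhalf hbip hcop).1 u)
  · intro _ hodd hind
    refine GraphPair.nontriviallyUnstable_iff hC hCc hthin hconn hbip ?_ fun hdiag φ =>
      GraphPair.mem_range_of_not_isIndepSet hC hthin hconn hpos hodd hdiag hind φ
    by_contra hcop
    obtain ⟨u, v, huv, hi⟩ := (GraphPair.of_not_loopCoprime hC hhalf hbip hcop).2 hodd
    exact hind u v huv hi
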